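/- All graphs are finite and simple. A b-coloring of a graph $G$ with $k$ colors is a proper vertex coloring with $k$ colors in which every color class contains a vertex having a neighbor in each of the other color classes; the b-chromatic number $b(G)$ is the largest $k$ for which $G$ has a b-coloring with $k$ colors. The hypercube $Q_n$ has as vertices all subsets of $\{1,\dots,n\}$, with $x,y$ adjacent if and only if $|x\triangle y|=1$. The $p$-th power $Q_n^p$ has the same vertices, two distinct vertices being adjacent if and only if their distance in $Q_n$ is at most $p$. (i) Let $n\ge 5$ be odd and let $p$ be an integer with $\frac{n+1}{2}\le p\le n-2$. If $$r=\sum_{i=0}^{p-\frac{n-1}{2}}\binom{n}{i}\qquad\text{and}\qquad s=\binom{p}{p-\frac{n-1}{2}},$$ then $b(Q_n^p)\le 2^{n-1}+\left\lfloor\frac{r-s}{2}\right\rfloor$. (ii) Let $n\ge 6$ be even and let $p$ be an integer with $\frac n2+1\le p\le n-2$. If $$r'=\sum_{i=0}^{p-\frac n2}\binom{n}{i}+\binom{n-1}{p-\frac n2}\qquad\text{and}\qquad s'=\binom{p-1}{p-\frac n2},$$ then $b(Q_n^p)\le 2^{n-1}+\left\lfloor\frac{r'-s'}{2}\right\rfloor$.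 -/

import Mathlib

/-- A proper coloring `C` is a b-coloring if every color class contains a color dominating vertex:
a vertex with a neighbor in each of the other color classes. In particular every color is used. -/
def SimpleGraph.Coloring.IsBColoring {V : Type*} {G : SimpleGraph V} {α : Type*}
    (C : G.Coloring α) : Prop :=
  ∀ c : α, ∃ v : V, C v = c ∧ ∀ d : α, d ≠ c → ∃ w : V, G.Adj v w ∧ C w = d

/-- `G` has a b-coloring using `k` colors. -/
def SimpleGraph.BColorable {V : Type*} (G : SimpleGraph V) (k : ℕ) : Prop :=
  ∃ C : G.Coloring (Fin k), C.IsBColoring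

/-- The b-chromatic number: the largest `k` such that `G` has a b-coloring using `k` colors
(for a finite graph this maximum exists, see `isGreatest_bChromaticNumber`). -/
noncomputable def SimpleGraph.bChromaticNumber {V : Type*} (G : SimpleGraph V) : ℕ :=
  sSup {k : ℕ | G.BColorable k}

/-- The `p`-th power of a graph: distinct vertices are adjacent iff their distance is at most `p`.
The extended distance is used, so that vertices in different components are never adjacent. -/
def SimpleGraph.power {V : Type*} (G : SimpleGraph V) (p : ℕ) : SimpleGraph V where
  Adj x y := x ≠ y ∧ G.edist x y ≤ (p : ℕ∞)
  symm := ⟨fun x y h => ⟨h.1.symm, by rw [SimpleGraph.edist_comm]; exact h.2⟩⟩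
  loopless := ⟨fun _ h => h.1 rfl⟩

/-- The hypercube `Q_n` on the subsets of an `n`-element set: two subsets are adjacent iff their
symmetric difference has exactly one element. -/
def hypercube (n : ℕ) : SimpleGraph (Finset (Fin n)) where
  Adj x y := (symmDiff x y).card = 1
  symm := ⟨fun x y h => by rw [symmDiff_comm]; exact h⟩
  loopless := ⟨fun x h => by simp at h⟩

theorem SimpleGraph.BColorable.le_card {V : Type*} [Finite V] {G : SimpleGraph V} {k : ℕ}
    (h : G.BColorable k) : k ≤ Nat.card V := by
  obtain ⟨C, hC⟩ := h
  have hs : Function.Surjective C := fun c => by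
    obtain ⟨v, hv, _⟩ := hC c
    exact ⟨v, hv⟩
  simpa using Nat.card_le_card_of_surjective C hs

theorem SimpleGraph.exists_bColorable {V : Type*} [Finite V] (G : SimpleGraph V) :
    ∃ k, G.BColorable k := by
  classical
  have hex : ∃ k, G.Colorable k := by
    cases nonempty_fintype V
    exact ⟨_, G.colorable_of_fintype⟩
  obtain ⟨C⟩ := Nat.find_spec hex
  refine ⟨Nat.find hex, C, ?_⟩
  by_contra hC
  unfold SimpleGraph.Coloring.IsBColoring at hC
  push Not at hC
  obtain ⟨c, hc⟩ := hC
  choose d hd hdw using hc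
  let D : G.Coloring {x : Fin (Nat.find hex) // x ≠ c} :=
    SimpleGraph.Coloring.mk
      (fun v => if h : C v = c then ⟨d v h, hd v h⟩ else ⟨C v, h⟩) (by
        intro v w hvw
        have hne := C.valid hvw
        by_cases hv : C v = c <;> by_cases hw : C w = c
        · exact absurd (hv.trans hw.symm) hne
        · simpa [hv, hw] using (hdw v hv w hvw).symm
        · simpa [hv, hw] using hdw w hw v hvw.symm
        · simpa [hv, hw] using hne)
  have hcol := D.colorable
  have hlt : Fintype.card {x : Fin (Nat.find hex) // x ≠ c} < Nat.find hex := by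
    simpa using Fintype.card_subtype_lt (p := fun x => x ≠ c) (x := c) (by simp)
  exact Nat.find_min hex hlt hcol

theorem SimpleGraph.isGreatest_bChromaticNumber {V : Type*} [Finite V] (G : SimpleGraph V) :
    IsGreatest {k : ℕ | G.BColorable k} G.bChromaticNumber := by
  have hb : BddAbove {k : ℕ | G.BColorable k} := ⟨Nat.card V, fun _ h => h.le_card⟩
  exact ⟨Nat.sSup_mem G.exists_bColorable hb, fun _ h => le_csSup hb h⟩

/-! In a b-coloring with `k` colors let `D` hold one dominating vertex per color and let `T` hold
the vertices that are alone in their class. All other classes have at least two vertices, so `2k ≤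
2^n + |T|`. A dominating vertex sees every other singleton class, so `T` and `D` lie within distance
`p` of each other (`exists_cross_of_bColorable_power`). Equivalently, `T` avoids the
`q`-neighborhood of the antipodes of `D`, where `q = n - p - 1`.

Isoperimetry then makes `T` small when `D` is large (`card_compl_iterate_closedNbhd_add_le`):
compressions replace the antipodal family by one closed under passing to larger sets, and
Kruskal-Katona bounds the `q`-fold shadow of its part in one layer. So `k ≥ 2^(n-1) + f` forces `|T|
≤ R - g`, with `R`, `g` the `r`, `s` (or `r'`, `s'`) of the statement. For smaller `k` the bound
follows from `g + 2f ≤ R + 2`, a binomial inequality. -/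

open Finset UV
open scoped FinsetFamily symmDiff

/-! ### Compressions and closed neighborhoods -/

section ClosedNeighborhood

variable {α : Type*} [DecidableEq α]

theorem UV.IsCompressed.symmDiff_mem {A : Finset (Finset α)} {u v a : Finset α}
    (h : IsCompressed u v A) (ha : a ∈ A) (hu : Disjoint u a) (hv : v ⊆ a) :
    a ∆ (u ∪ v) ∈ A := by
  have := sup_sdiff_mem_of_mem_compression (u := u) (v := v) (s := A) (by rwa [h.eq]) hv hu
  convert this using 1
  rw [disjoint_left] at hu
  ext i
  have h1 := @hu i
  have h2 := @hv i
  simp only [mem_symmDiff, mem_union, sup_eq_union, mem_sdiff]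
  tauto

theorem mem_compression_of_mem {A : Finset (Finset α)} {u v y : Finset α} (hy : y ∈ A)
    (h : Disjoint u y → v ⊆ y → y ∆ (u ∪ v) ∈ A) : y ∈ 𝓒 u v A := by
  rw [mem_compression]
  left
  refine ⟨hy, ?_⟩
  unfold compress
  split_ifs with hc
  · convert h hc.1 hc.2 using 1
    have h1 := disjoint_left.1 hc.1
    have h2 := hc.2
    ext i
    have h1 := @h1 i
    have h2 := @h2 i
    simp only [mem_symmDiff, mem_union, sup_eq_union, mem_sdiff]
    tauto
  · exact hy

theorem mem_compression_of_symmDiff_mem {A : Finset (Finset α)} {u v y : Finset α}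
    (h1 : Disjoint v y) (h2 : u ⊆ y) (h3 : y ∆ (u ∪ v) ∈ A) : y ∈ 𝓒 u v A := by
  have := compress_mem_compression (u := u) (v := v) h3
  rw [← compress_of_disjoint_of_le' h1 h2]
  convert this using 2
  rw [disjoint_left] at h1
  ext i
  have h1 := @h1 i
  have h2 := @h2 i
  simp only [mem_symmDiff, mem_union, sup_eq_union, mem_sdiff]
  tauto

theorem mem_or_of_mem_compression {A : Finset (Finset α)} {u v b : Finset α}
    (hb : b ∈ 𝓒 u v A) : (b ∈ A ∧ (Disjoint u b → v ⊆ b → b ∆ (u ∪ v) ∈ A)) ∨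
      (Disjoint v b ∧ u ⊆ b ∧ b ∆ (u ∪ v) ∈ A) := by
  by_cases hbA : b ∈ A
  · refine Or.inl ⟨hbA, fun h3 h4 => ?_⟩
    convert sup_sdiff_mem_of_mem_compression hb h4 h3 using 1
    rw [disjoint_left] at h3
    ext i
    have h3 := @h3 i
    have h4 := @h4 i
    simp only [mem_symmDiff, mem_union, sup_eq_union, mem_sdiff]
    tauto
  · have h1 := disjoint_of_mem_compression_of_notMem hb hbA
    have h2 := le_of_mem_compression_of_notMem hb hbA
    refine Or.inr ⟨h1, h2, ?_⟩
    convert sup_sdiff_mem_of_mem_compression_of_notMem hb hbA using 1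
    rw [disjoint_left] at h1
    ext i
    have h1 := @h1 i
    have h2 := @h2 i
    simp only [mem_symmDiff, mem_union, sup_eq_union, mem_sdiff]
    tauto

/-- All compressions obtained from `(u, v)` by deleting an element of `u` and, when possible, one
of `v`, leave `A` unchanged. -/
def SubCompressed (u v : Finset α) (A : Finset (Finset α)) : Prop :=
  (∀ x ∈ u, ∀ y ∈ v, IsCompressed (u.erase x) (v.erase y) A) ∧
    (v = ∅ → ∀ x ∈ u, u ≠ {x} → IsCompressed (u.erase x) v A)

variable [Fintype α]

/-- The closed neighborhood of a set family in the hypercube. -/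
def closedNbhd (A : Finset (Finset α)) : Finset (Finset α) := A ∪ (∂ A ∪ ∂⁺ A)

theorem mem_closedNbhd {A : Finset (Finset α)} {y : Finset α} :
    y ∈ closedNbhd A ↔ y ∈ A ∨ ∃ e, y ∆ {e} ∈ A := by
  simp only [closedNbhd, mem_union, mem_shadow_iff_insert_mem, mem_upShadow_iff_erase_mem]
  have h1 : ∀ e ∉ y, insert e y = y ∆ {e} := by
    intro e he; ext i; by_cases hi : i = e <;> simp [mem_symmDiff, hi, he]
  have h2 : ∀ e ∈ y, y.erase e = y ∆ {e} := by
    intro e he; ext i; by_cases hi : i = e <;> simp [mem_symmDiff, hi, he]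
  constructor
  · rintro (h | ⟨e, he, h⟩ | ⟨e, he, h⟩)
    · exact Or.inl h
    · exact Or.inr ⟨e, h1 e he ▸ h⟩
    · exact Or.inr ⟨e, h2 e he ▸ h⟩
  · rintro (h | ⟨e, h⟩)
    · exact Or.inl h
    · by_cases he : e ∈ y
      · exact Or.inr (Or.inr ⟨e, he, h2 e he ▸ h⟩)
      · exact Or.inr (Or.inl ⟨e, he, h1 e he ▸ h⟩)

theorem closedNbhd_mono {A B : Finset (Finset α)} (h : A ⊆ B) : closedNbhd A ⊆ closedNbhd B :=
  union_subset_union h (union_subset_union (shadow_mono h) (upShadow_monotone h))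

theorem subset_closedNbhd (A : Finset (Finset α)) : A ⊆ closedNbhd A := subset_union_left

theorem shadow_subset_closedNbhd (A : Finset (Finset α)) : ∂ A ⊆ closedNbhd A :=
  subset_union_left.trans subset_union_right

/-- Flipping an element outside `u ∪ v` commutes with compression. A flip inside `u ∪ v` changes
whether a set can be compressed; the smaller compressions in `SubCompressed` then supply the
required neighbor. -/
theorem closedNbhd_compression_subset {A : Finset (Finset α)} {u v : Finset α}
    (huv : Disjoint u v) (hcard : #v < #u) (h : SubCompressed u v A) :
    closedNbhd (𝓒 u v A) ⊆ 𝓒 u v (closedNbhd A) := by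
  obtain ⟨h1, h2⟩ := h
  have hu : u.Nonempty := by rw [← card_pos]; omega
  obtain ⟨g, hg⟩ := hu
  rw [disjoint_left] at huv
  -- Where it applies, a compression is the symmetric difference with `u ∪ v`, so it commutes with
  -- flips. The smaller one tolerates a defect at `x` and one at `y`.
  replace h1 : ∀ x ∈ u, ∀ y ∈ v, ∀ a ∈ A, (∀ i ∈ u, i ∈ a → i = x) → (∀ i ∈ v, i ∉ a → i = y) →
      ((a ∆ (u ∪ v)) ∆ {x}) ∆ {y} ∈ A := fun x hx y hy a ha h3 h4 => by
    have := (h1 x hx y hy).symmDiff_mem ha (disjoint_left.2 fun i hi hia => ?_) fun i hi => ?_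
    · convert this using 1
      have hxv := huv hx
      have hyu : y ∉ u := fun h => huv h hy
      ext i
      have : i ∈ u → i ∉ v := @huv i
      by_cases hix : i = x
      · subst hix
        have : i ≠ y := by rintro rfl; exact hyu hx
        simp [mem_symmDiff, *]
      · by_cases hiy : i = y
        · subst hiy
          simp [mem_symmDiff, *]
        · simp [mem_symmDiff, *]
    · rw [mem_erase] at hi
      exact hi.1 (h3 i hi.2 hia)
    · rw [mem_erase] at hi
      by_contra hia
      exact hi.1 (h4 i hi.2 hia)
  replace h2 : v = ∅ → ∀ x ∈ u, u ≠ {x} → ∀ a ∈ A, (∀ i ∈ u, i ∈ a → i = x) →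
      (a ∆ (u ∪ v)) ∆ {x} ∈ A := fun hv x hx hux a ha h3 => by
    have := (h2 hv x hx hux).symmDiff_mem ha (disjoint_left.2 fun i hi hia => ?_) (by simp [hv])
    · convert this using 1
      subst hv
      ext i
      by_cases hix : i = x
      · subst hix
        simp [mem_symmDiff, *]
      · simp [mem_symmDiff, *]
    · rw [mem_erase] at hi
      exact hi.1 (h3 i hi.2 hia)
  have hN1 : ∀ y, y ∈ A → y ∈ closedNbhd A := fun y hy => mem_closedNbhd.2 (Or.inl hy)
  have hN2 : ∀ y e, y ∆ {e} ∈ A → y ∈ closedNbhd A := fun y e hy => mem_closedNbhd.2 (Or.inr ⟨e, hy⟩)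
  have hcancel : ∀ y z : Finset α, (y ∆ z) ∆ z = y := fun y z => symmDiff_symmDiff_cancel_right z y
  intro y hy
  rw [mem_closedNbhd] at hy
  rcases hy with hy | ⟨e, hy⟩
  · rcases mem_or_of_mem_compression hy with ⟨h3, h4⟩ | ⟨h3, h4, h5⟩
    · exact mem_compression_of_mem (hN1 _ h3) fun h5 h6 => hN1 _ (h4 h5 h6)
    · exact mem_compression_of_symmDiff_mem h3 h4 (hN1 _ h5)
  generalize hb : y ∆ {e} = b at hy
  obtain rfl : y = b ∆ {e} := by rw [← hb, hcancel]
  have hmem : ∀ i, i ∈ b ∆ {e} ↔ (i ∈ b ↔ i ≠ e) := by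
    intro i; simp only [mem_symmDiff, mem_singleton]; tauto
  have hcomm : ∀ z : Finset α, (b ∆ {e}) ∆ z = (b ∆ z) ∆ {e} := fun z => symmDiff_right_comm _ _ _
  rcases mem_or_of_mem_compression hy with ⟨h3, h4⟩ | ⟨h3, h4, h5⟩
  · refine mem_compression_of_mem (hN2 _ e (by rwa [hcancel])) fun h5 h6 => ?_
    rw [disjoint_left] at h5
    by_cases heu : e ∈ u
    · have hub : ∀ i ∈ u, i ∈ b → i = e := fun i hi hib => by
        by_contra hie
        exact h5 hi ((hmem i).2 (by tauto))
      rcases v.eq_empty_or_nonempty with hv | ⟨f, hf⟩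
      · by_cases hue : u = {e}
        · refine hN1 _ ?_
          rw [hue, hv, union_empty, hcancel]
          exact h3
        · refine hN1 _ ?_
          rw [hcomm]
          exact h2 hv e heu hue b h3 hub
      · refine hN2 _ f ?_
        rw [hcomm]
        refine h1 e heu f hf b h3 hub fun i hi hib => ?_
        have := (hmem i).1 (h6 hi)
        have : i = e := by tauto
        exact absurd hi (this ▸ huv heu)
    · by_cases hev : e ∈ v
      · refine hN2 _ g ?_
        rw [hcomm, symmDiff_right_comm]
        refine h1 g hg e hev b h3 (fun i hi hib => ?_) fun i hi hib => ?_
        · have := mt (hmem i).2 (h5 hi)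
          have : i = e := by tauto
          exact absurd (this ▸ hi) heu
        · have := (hmem i).1 (h6 hi)
          tauto
      · refine hN2 _ e ?_
        rw [hcomm, hcancel]
        refine h4 (disjoint_left.2 fun i hi hib => ?_) fun i hi => ?_
        · have := mt (hmem i).2 (h5 hi)
          have : i = e := by tauto
          exact heu (this ▸ hi)
        · have := (hmem i).1 (h6 hi)
          have h7 : i ≠ e := by rintro rfl; exact hev hi
          tauto
  -- Here `b` is the image of `b ∆ (u ∪ v) ∈ A`. If `e ∈ u ∪ v`, then `b ∆ {e}` already lies in
  -- `closedNbhd A` and stays there; otherwise it is the image of a neighbor of `b ∆ (u ∪ v)`.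
  · rw [disjoint_left] at h3
    have hmem' : ∀ i, i ∈ b ∆ (u ∪ v) ↔ (i ∈ b ↔ i ∉ u ∧ i ∉ v) := by
      intro i; simp only [mem_symmDiff, mem_union]; tauto
    have hub : ∀ i ∈ u, i ∉ b ∆ (u ∪ v) := fun i hi => by
      rw [hmem']; have := h4 hi; tauto
    have hvb : ∀ i ∈ v, i ∈ b ∆ (u ∪ v) := fun i hi => by
      rw [hmem']; have := h3 hi; tauto
    by_cases heu : e ∈ u
    · rcases v.eq_empty_or_nonempty with hv | ⟨f, hf⟩
      · by_cases hue : u = {e}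
        · have : b ∆ {e} ∈ A := by rwa [hue, hv, union_empty] at h5
          refine mem_compression_of_mem (hN1 _ this) fun _ _ => hN2 _ e ?_
          rwa [hue, hv, union_empty, hcancel]
        · have := h2 hv e heu hue _ h5 fun i hi hib => absurd hib (hub i hi)
          rw [hcancel] at this
          refine mem_compression_of_mem (hN1 _ this) fun h6 _ => ?_
          exfalso
          obtain ⟨f, hf, hfe⟩ : ∃ f ∈ u, f ≠ e := by
            by_contra! hc
            exact hue (eq_singleton_iff_unique_mem.2 ⟨heu, hc⟩)
          exact disjoint_left.1 h6 hf ((hmem f).2 (by have := h4 hf; tauto))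
      · have := h1 e heu f hf _ h5 (fun i hi hib => absurd hib (hub i hi))
          fun i hi hib => absurd (hvb i hi) hib
        rw [hcancel] at this
        refine mem_compression_of_mem (hN2 _ f this) fun _ h7 => ?_
        have h8 := (hmem f).1 (h7 hf)
        have h9 := h3 hf
        have : f = e := by tauto
        exact absurd hf (this ▸ huv heu)
    · by_cases hev : e ∈ v
      · have := h1 g hg e hev _ h5 (fun i hi hib => absurd hib (hub i hi))
          fun i hi hib => absurd (hvb i hi) hib
        rw [hcancel, symmDiff_right_comm] at this
        refine mem_compression_of_mem (hN2 _ g this) fun h7 _ => ?_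
        have h8 := mt (hmem g).2 (disjoint_left.1 h7 hg)
        have h9 := h4 hg
        have : g = e := by tauto
        exact absurd (this ▸ hg) heu
      · refine mem_compression_of_symmDiff_mem (disjoint_left.2 fun i hi hib => ?_)
          (fun i hi => ?_) (hN2 _ e ?_)
        · have h8 := (hmem i).1 hib
          have h9 := h3 hi
          have : i = e := by tauto
          exact hev (this ▸ hi)
        · refine (hmem i).2 ?_
          have h9 := h4 hi
          have : i ≠ e := by rintro rfl; exact heu hi
          tauto
        · rwa [hcomm, hcancel]

theorem UV.IsCompressed.closedNbhd {A : Finset (Finset α)} {u v : Finset α}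
    (huv : Disjoint u v) (hcard : #v < #u) (h : SubCompressed u v A) (hA : IsCompressed u v A) :
    IsCompressed u v (closedNbhd A) := by
  have h1 := closedNbhd_compression_subset huv hcard h
  rw [hA.eq] at h1
  exact (eq_of_subset_of_card_le h1 (card_compression _ _ _).le).symm

theorem iterate_closedNbhd_mono {A B : Finset (Finset α)} (h : A ⊆ B) (q : ℕ) :
    closedNbhd^[q] A ⊆ closedNbhd^[q] B := by
  induction q generalizing A B with
  | zero => exact h
  | succ q ih => exact ih (closedNbhd_mono h)

theorem exists_card_symmDiff_le_of_mem_iterate_closedNbhd {A : Finset (Finset α)} {q : ℕ}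
    {x : Finset α} (hx : x ∈ closedNbhd^[q] A) : ∃ a ∈ A, #(x ∆ a) ≤ q := by
  induction q generalizing x with
  | zero => exact ⟨x, hx, by simp⟩
  | succ q ih =>
    rw [Function.iterate_succ_apply', mem_closedNbhd] at hx
    rcases hx with hx | ⟨e, hx⟩
    · obtain ⟨a, ha, h⟩ := ih hx
      exact ⟨a, ha, by omega⟩
    · obtain ⟨a, ha, h⟩ := ih hx
      refine ⟨a, ha, ?_⟩
      have h1 : x ∆ a ⊆ insert e ((x ∆ {e}) ∆ a) := by
        intro i
        simp only [mem_symmDiff, mem_insert, mem_singleton]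
        tauto
      have := (card_le_card h1).trans (card_insert_le _ _)
      omega

theorem iterate_shadow_subset_iterate_closedNbhd (A : Finset (Finset α)) (q : ℕ) :
    ∂^[q] A ⊆ closedNbhd^[q] A := by
  induction q generalizing A with
  | zero => rfl
  | succ q ih =>
    exact (ih _).trans (iterate_closedNbhd_mono (shadow_subset_closedNbhd A) q)

end ClosedNeighborhood

/-! ### Isoperimetry in the hypercube -/

section Isoperimetry

variable {α : Type*} [DecidableEq α]

theorem card_compress_of_ne {u v a : Finset α} (hcard : #v < #u) (h : compress u v a ≠ a) :
    #a < #(compress u v a) := by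
  unfold compress at h ⊢
  split_ifs at h ⊢ with hc
  · have h1 : #(a ∪ u) = #a + #u := card_union_of_disjoint hc.1.symm
    have h2 := card_sdiff_of_subset (hc.2.trans (le_sup_left (b := u)))
    rw [sup_eq_union] at h2 ⊢
    have := card_le_card hc.2
    omega
  · exact absurd rfl h

/-- The total cardinality serves as a potential: a maximizer is fixed by every admissible
compression. -/
theorem sum_card_lt_sum_card_compression {A : Finset (Finset α)} {u v : Finset α}
    (hcard : #v < #u) (hA : ¬ IsCompressed u v A) : ∑ a ∈ A, #a < ∑ a ∈ 𝓒 u v A, #a := by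
  have uA : {a ∈ A | compress u v a ∈ A} ∪ {a ∈ A | compress u v a ∉ A} = A :=
    filter_union_filter_not_eq _ _
  have hne : {a ∈ A | compress u v a ∉ A}.Nonempty := by
    by_contra hc
    rw [not_nonempty_iff_eq_empty] at hc
    apply hA
    rw [hc, union_empty] at uA
    rw [IsCompressed, compression, filter_image, hc, image_empty, union_empty, uA]
  rw [compression, sum_union compress_disjoint, filter_image, sum_image compress_injOn]
  conv_lhs => rw [← uA]
  rw [sum_union (disjoint_filter_filter_not _ _ _), add_lt_add_iff_left]
  refine sum_lt_sum_of_nonempty hne fun a ha => card_compress_of_ne hcard fun h => ?_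
  rw [mem_filter, h] at ha
  exact ha.2 ha.1

theorem subCompressed_of_forall {A : Finset (Finset α)} {u v : Finset α} (huv : Disjoint u v)
    (hcard : #v < #u)
    (h : ∀ u' v', Disjoint u' v' → #v' < #u' → #u' < #u → IsCompressed u' v' A) :
    SubCompressed u v A := by
  refine ⟨fun x hx y hy => ?_, fun hv x hx hux => ?_⟩
  · have h1 := card_erase_add_one hx
    have h2 := card_erase_add_one hy
    exact h _ _ (huv.mono (erase_subset _ _) (erase_subset _ _)) (by omega) (by omega)
  · have h1 := card_erase_add_one hx
    refine h _ _ (huv.mono_left (erase_subset _ _)) ?_ (by omega)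
    rw [hv, card_empty, card_pos]
    by_contra hc
    rw [not_nonempty_iff_eq_empty, erase_eq_empty_iff] at hc
    rcases hc with hc | hc
    · simp [hc] at hx
    · exact hux hc

variable [Fintype α]

theorem isCompressed_closedNbhd_of_forall {A : Finset (Finset α)} {k : ℕ}
    (h : ∀ u' v', Disjoint u' v' → #v' < #u' → #u' < k → IsCompressed u' v' A) :
    ∀ u' v', Disjoint u' v' → #v' < #u' → #u' < k → IsCompressed u' v' (closedNbhd A) :=
  fun u' v' h1 h2 h3 => (h u' v' h1 h2 h3).closedNbhd h1 h2
    (subCompressed_of_forall h1 h2 fun u v h4 h5 h6 => h u v h4 h5 (h6.trans h3))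

theorem iterate_closedNbhd_compression_subset {A : Finset (Finset α)} {u v : Finset α}
    (huv : Disjoint u v) (hcard : #v < #u)
    (h : ∀ u' v', Disjoint u' v' → #v' < #u' → #u' < #u → IsCompressed u' v' A) (q : ℕ) :
    closedNbhd^[q] (𝓒 u v A) ⊆ 𝓒 u v (closedNbhd^[q] A) := by
  induction q generalizing A with
  | zero => rfl
  | succ q ih =>
    exact (iterate_closedNbhd_mono (closedNbhd_compression_subset huv hcard
      (subCompressed_of_forall huv hcard h)) q).trans (ih (isCompressed_closedNbhd_of_forall h))

/-- A family can be replaced by one of the same size that is closed under passing to a set of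
larger cardinality, without increasing its iterated closed neighborhood. -/
theorem exists_card_closed_le_iterate_closedNbhd (A : Finset (Finset α)) (q : ℕ) :
    ∃ B : Finset (Finset α), #B = #A ∧ #(closedNbhd^[q] B) ≤ #(closedNbhd^[q] A) ∧
      ∀ a ∈ B, ∀ b, #a < #b → b ∈ B := by
  obtain ⟨B, hB, hmax⟩ := exists_max_image
    {B : Finset (Finset α) | #B = #A ∧ #(closedNbhd^[q] B) ≤ #(closedNbhd^[q] A)}
    (fun B => ∑ a ∈ B, #a) ⟨A, by simp⟩
  simp only [mem_filter, mem_univ, true_and] at hB hmax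
  have key : ∀ k, ∀ u v : Finset α, Disjoint u v → #v < #u → #u < k → IsCompressed u v B := by
    intro k
    -- Induction on the size of `u`, since a compression respects neighborhoods only once all
    -- smaller ones fix the family.
    induction k with
    | zero => intro u v _ _ h; omega
    | succ k ih =>
      intro u v huv hcard hk
      by_contra hc
      refine (sum_card_lt_sum_card_compression hcard hc).not_ge (hmax _ ⟨?_, ?_⟩)
      · rw [card_compression, hB.1]
      · refine (card_le_card (iterate_closedNbhd_compression_subset huv hcard
          (fun u' v' h1 h2 h3 => ih u' v' h1 h2 (by omega)) q)).trans ?_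
        rw [card_compression]
        exact hB.2
  refine ⟨B, hB.1, hB.2, fun a ha b hab => ?_⟩
  have hcard : #(a \ b) < #(b \ a) := by
    have h1 := card_sdiff_add_card_inter a b
    have h2 := card_sdiff_add_card_inter b a
    rw [inter_comm] at h2
    omega
  -- This compression carries `a` exactly to `b`.
  have := (key _ (b \ a) (a \ b) disjoint_sdiff_sdiff hcard (Nat.lt_succ_self _)).symmDiff_mem ha
    disjoint_sdiff_self_left sdiff_subset
  convert this using 1
  ext i
  simp only [mem_symmDiff, mem_union, mem_sdiff]
  tauto

omit [DecidableEq α] in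
theorem card_filter_card_le (l : ℕ) :
    #{x : Finset α | #x ≤ l} = ∑ i ∈ range (l + 1), (Fintype.card α).choose i := by
  rw [card_eq_sum_card_fiberwise (f := card) (t := range (l + 1))]
  · refine sum_congr rfl fun i hi => ?_
    rw [← card_univ, ← card_powersetCard]
    congr 1
    ext x
    simp only [mem_filter, mem_univ, true_and, mem_powersetCard, subset_univ, mem_range] at hi ⊢
    omega
  · intro x hx
    simp at hx ⊢
    omega

theorem mem_iterate_closedNbhd_of_card_le {l q : ℕ} {B : Finset (Finset α)}
    (hB : ∀ b : Finset α, l < #b → b ∈ B) (hl : l < Fintype.card α) {x : Finset α}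
    (hx : l < #x + q) : x ∈ closedNbhd^[q] B := by
  induction q generalizing l B with
  | zero => exact hB x hx
  | succ q ih =>
    rcases l with - | l
    -- At `l = 0` one step already reaches `∅` from a singleton, hence gives every set.
    · have h : ∀ y : Finset α, y ∈ closedNbhd B := by
        intro y
        by_cases hy : 0 < #y
        · exact subset_closedNbhd _ (hB y hy)
        · obtain ⟨e⟩ : Nonempty α := Fintype.card_pos_iff.1 hl
          have : y = ∅ := by rw [← card_eq_zero]; omega
          subst this
          exact shadow_subset_closedNbhd _ (mem_shadow_iff_insert_mem.2
            ⟨e, by simp, hB _ (by simp)⟩)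
      have huniv : ∀ q, ∀ C : Finset (Finset α), (∀ y, y ∈ C) → x ∈ closedNbhd^[q] C := by
        intro q
        induction q with
        | zero => intro C hC; exact hC x
        | succ q ih => intro C hC; exact ih _ fun y => subset_closedNbhd _ (hC y)
      exact huniv q _ h
    · refine ih (l := l) (fun b hb => ?_) (by omega) (by omega)
      by_cases hb' : l + 1 < #b
      · exact subset_closedNbhd _ (hB b hb')
      · obtain ⟨e, he⟩ : ∃ e, e ∉ b := by
          by_contra! hc
          have := card_univ (α := α) ▸ card_le_card (fun i _ => hc i : (univ : Finset α) ⊆ b)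
          omega
        refine shadow_subset_closedNbhd _ (mem_shadow_iff_insert_mem.2 ⟨e, he, hB _ ?_⟩)
        rw [card_insert_of_notMem he]
        omega

/-- An isoperimetric inequality: the vertices that are far from a large family are few. -/
theorem card_compl_iterate_closedNbhd_add_le {A : Finset (Finset α)} {l q f g : ℕ}
    (hl : l < Fintype.card α) (hq : q ≤ l)
    (hA : 2 ^ Fintype.card α + f ≤ #A + ∑ i ∈ range (l + 1), (Fintype.card α).choose i)
    (hf : f ≤ (Fintype.card α).choose l)
    (hg : ∀ F : Finset (Finset α), (F : Set (Finset α)).Sized l → f ≤ #F → g ≤ #(∂^[q] F)) :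
    #(closedNbhd^[q] A)ᶜ + g ≤ ∑ i ∈ range (l - q + 1), (Fintype.card α).choose i := by
  obtain ⟨B, hBA, hN, hB⟩ := exists_card_closed_le_iterate_closedNbhd A q
  have hle := card_filter_card_le (α := α) l
  have hcompl := card_filter_add_card_filter_not (s := (univ : Finset (Finset α)))
    (fun x => #x ≤ l)
  rw [card_univ, Fintype.card_finset] at hcompl
  have htop : ∀ b : Finset α, l < #b → b ∈ B := by
    intro b hb
    by_contra hc
    have h1 : B ⊂ ({x : Finset α | ¬ #x ≤ l} : Finset (Finset α)) := by
      refine (ssubset_iff_of_subset fun a ha => ?_).2 ⟨b, by simpa using hb, hc⟩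
      simp only [mem_filter, mem_univ, true_and]
      intro hal
      exact hc (hB a ha b (by omega))
    have := card_lt_card h1
    omega
  set F : Finset (Finset α) := {x ∈ B | #x = l} with hF
  have hFs : (F : Set (Finset α)).Sized l := fun x hx => by simp [hF] at hx; exact hx.2
  -- Either `B` reaches below layer `l`, and then contains that whole layer, or all its surplus over
  -- the higher layers lies in `F`.
  have hFf : f ≤ #F := by
    by_cases hlow : ∃ a ∈ B, #a < l
    · obtain ⟨a, ha, hal⟩ := hlow
      have : F = powersetCard l univ := by
        ext x
        simp only [hF, mem_filter, mem_powersetCard, subset_univ, true_and, and_iff_right_iff_imp]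
        intro hx
        exact hB a ha x (by omega)
      rw [this, card_powersetCard, card_univ]
      exact hf
    · push Not at hlow
      have h1 : B ⊆ F ∪ ({x : Finset α | ¬ #x ≤ l} : Finset (Finset α)) := by
        intro x hx
        have := hlow x hx
        simp only [hF, mem_union, mem_filter, mem_univ, true_and, hx]
        omega
      have := (card_le_card h1).trans (card_union_le _ _)
      omega
  have hshadow : ∂^[q] F ⊆ closedNbhd^[q] B :=
    (iterate_shadow_subset_iterate_closedNbhd F q).trans
      (iterate_closedNbhd_mono (filter_subset _ _) q)
  have hsub : (closedNbhd^[q] B)ᶜ ∪ ∂^[q] F ⊆ ({x : Finset α | #x ≤ l - q} : Finset _) := by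
    intro x hx
    simp only [mem_union, mem_compl, mem_filter, mem_univ, true_and] at hx ⊢
    rcases hx with hx | hx
    · by_contra hc
      exact hx (mem_iterate_closedNbhd_of_card_le htop hl (by omega))
    · exact (hFs.shadow_iterate hx).le
  have hdisj : Disjoint (closedNbhd^[q] B)ᶜ (∂^[q] F) :=
    disjoint_left.2 fun x hx hx' => (mem_compl.1 hx) (hshadow hx')
  have h2 := card_le_card hsub
  rw [card_union_of_disjoint hdisj, card_filter_card_le] at h2
  have h3 := hg F hFs hFf
  have h4 : #(closedNbhd^[q] A)ᶜ ≤ #(closedNbhd^[q] B)ᶜ := by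
    rw [card_compl, card_compl]
    omega
  omega

end Isoperimetry

/-! ### Kruskal-Katona for the required layer sizes -/

section Cascade

/-- The colex initial segment of `(r + 1)`-sets consisting of the sets that avoid the last element
and of those whose other elements are less than `a`. -/
def cascadeFamily (N a r : ℕ) : Finset (Finset (Fin (N + 1))) :=
  {x | #x = r + 1 ∧ (Fin.last N ∈ x → ∀ i ∈ x, i ≠ Fin.last N → (i : ℕ) < a)}

theorem card_filter_val_lt {N a : ℕ} (ha : a ≤ N) :
    #{i : Fin (N + 1) | (i : ℕ) < a} = a := by
  rw [Fin.card_filter_val_lt]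
  omega

theorem card_cascadeFamily {N a : ℕ} (r : ℕ) (ha : a ≤ N) :
    #(cascadeFamily N a r) = N.choose (r + 1) + a.choose r := by
  have hlast : Fin.last N ∉ ({i : Fin (N + 1) | (i : ℕ) < a} : Finset _) := by simp [ha]
  have h1 : cascadeFamily N a r = powersetCard (r + 1) (univ.erase (Fin.last N)) ∪
      (powersetCard r {i : Fin (N + 1) | (i : ℕ) < a}).image (insert (Fin.last N)) := by
    ext x
    simp only [cascadeFamily, mem_filter, mem_univ, true_and, mem_union, mem_powersetCard,
      mem_image, subset_iff, mem_erase]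
    constructor
    · rintro ⟨h1, h2⟩
      by_cases hx : Fin.last N ∈ x
      · refine Or.inr ⟨x.erase (Fin.last N), ⟨fun i hi => ?_, ?_⟩, insert_erase hx⟩
        · rw [mem_erase] at hi
          exact h2 hx i hi.2 hi.1
        · rw [card_erase_of_mem hx, h1, Nat.add_sub_cancel]
      · refine Or.inl ⟨fun i hi => ⟨?_, trivial⟩, h1⟩
        rintro rfl
        exact hx hi
    · rintro (⟨h1, h2⟩ | ⟨y, ⟨h1, h2⟩, rfl⟩)
      · exact ⟨h2, fun hx => absurd rfl (h1 hx).1⟩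
      · refine ⟨?_, fun _ i hi hne => h1 (mem_of_mem_insert_of_ne hi hne)⟩
        rw [card_insert_of_notMem, h2]
        intro hy
        have := h1 hy
        simp at this
        omega
  have hnot : ∀ y ∈ powersetCard r ({i : Fin (N + 1) | (i : ℕ) < a} : Finset _),
      Fin.last N ∉ y := fun y hy hl => hlast ((mem_powersetCard.1 hy).1 hl)
  rw [h1, card_union_of_disjoint, card_powersetCard, card_erase_of_mem (mem_univ _),
    card_image_of_injOn, card_powersetCard, card_filter_val_lt ha]
  · simp
  · intro y hy z hz hyz
    rw [← erase_insert (hnot y hy), ← erase_insert (hnot z hz)]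
    exact congrArg (fun t => t.erase (Fin.last N)) hyz
  · rw [disjoint_left]
    intro x hx hx'
    obtain ⟨y, -, rfl⟩ := mem_image.1 hx'
    simpa using (mem_powersetCard.1 hx).1 (mem_insert_self _ _)

theorem isInitSeg_cascadeFamily (N a r : ℕ) : Colex.IsInitSeg (cascadeFamily N a r) (r + 1) := by
  refine ⟨fun x hx => ?_, fun s t hs ⟨hts, ht⟩ => ?_⟩
  · simp only [cascadeFamily, coe_filter, mem_univ, true_and, Set.mem_ofPred_eq] at hx
    exact hx.1
  · simp only [cascadeFamily, mem_filter, mem_univ, true_and] at hs ⊢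
    refine ⟨ht, fun hlt i hi hne => ?_⟩
    have hls : Fin.last N ∈ s := by
      by_contra hc
      have := Colex.forall_lt_mono hts.le (a := Fin.last N) (fun b hb => lt_of_le_of_ne
        (Fin.le_last b) (by rintro rfl; exact hc hb)) _ hlt
      exact lt_irrefl _ this
    by_contra hia
    -- Deleting the common top element preserves the colex order, so the bound `a` on the rest of
    -- `s` passes to `t`.
    have h1 : toColex (t \ {Fin.last N}) ≤ toColex (s \ {Fin.last N}) :=
      (Colex.toColex_sdiff_le_toColex_sdiff (singleton_subset_iff.2 hlt) (singleton_subset_iff.2 hls)).2 hts.le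
    have := Colex.forall_lt_mono h1 (a := i) (fun b hb => ?_) i (by simp [hi, hne])
    · exact lt_irrefl _ this
    · simp only [mem_sdiff, mem_singleton] at hb
      have := hs.2 hls b hb.1 hb.2
      rw [Fin.lt_def]
      omega

theorem cascadeFamily_subset_iterate_shadow {N a r q : ℕ} (ha : a ≤ N) (hra : r ≤ a)
    (hrN : r + 1 ≤ N) (hq : q ≤ r) :
    cascadeFamily N a (r - q) ⊆ ∂^[q] (cascadeFamily N a r) := by
  intro x hx
  rw [mem_shadow_iterate_iff_exists_mem_card_add]
  simp only [cascadeFamily, mem_filter, mem_univ, true_and] at hx ⊢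
  by_cases hl : Fin.last N ∈ x
  · obtain ⟨y, hxy, hy, hc⟩ := exists_subsuperset_card_eq (n := r + 1) (s := x)
      (t := insert (Fin.last N) ({i : Fin (N + 1) | (i : ℕ) < a} : Finset _))
      (fun i hi => by
        by_cases h : i = Fin.last N
        · simp [h]
        · simp [hx.2 hl i hi h]) (by omega) (by
        rw [card_insert_of_notMem (by simp [ha]), card_filter_val_lt ha]
        omega)
    refine ⟨y, ⟨hc, fun _ i hi hne => ?_⟩, hxy, by omega⟩
    simpa using mem_of_mem_insert_of_ne (hy hi) hne
  · obtain ⟨y, hxy, hy, hc⟩ := exists_subsuperset_card_eq (n := r + 1) (s := x)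
      (t := univ.erase (Fin.last N))
      (fun i hi => by
        rw [mem_erase]
        refine ⟨?_, mem_univ _⟩
        rintro rfl
        exact hl hi) (by omega) (by
        rw [card_erase_of_mem (mem_univ _), card_univ, Fintype.card_fin]
        omega)
    refine ⟨y, ⟨hc, fun h => ?_⟩, hxy, by omega⟩
    simpa using hy h

/-- The Kruskal-Katona theorem for sizes with a two-term cascade representation. -/
theorem two_term_le_card_iterate_shadow {n N a r q : ℕ} (hn : n = N + 1) (ha : a ≤ N) (hra : r ≤ a)
    (hrN : r + 1 ≤ N) (hq : q ≤ r) {F : Finset (Finset (Fin n))}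
    (hF : (F : Set (Finset (Fin n))).Sized (r + 1)) (h : N.choose (r + 1) + a.choose r ≤ #F) :
    N.choose (r - q + 1) + a.choose (r - q) ≤ #(∂^[q] F) := by
  subst hn
  rw [← card_cascadeFamily _ ha] at h ⊢
  exact (card_le_card (cascadeFamily_subset_iterate_shadow ha hra hrN hq)).trans
    (iterated_kk hF h (isInitSeg_cascadeFamily N a r))

/-- Two distinct sets of size `l + 1` cover at least `l + 2` points, and every covered point is a
singleton in the `l`-fold shadow. -/
theorem add_two_le_card_iterate_shadow {n l : ℕ} {F : Finset (Finset (Fin n))}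
    (hF : (F : Set (Finset (Fin n))).Sized (l + 1)) (h : 2 ≤ #F) : l + 2 ≤ #(∂^[l] F) := by
  obtain ⟨x, hx, y, hy, hxy⟩ := one_lt_card.1 (show 1 < #F by omega)
  have h1 : l + 2 ≤ #(x ∪ y) := by
    by_contra hc
    have hx' : #x = l + 1 := hF hx
    have hy' : #y = l + 1 := hF hy
    have e1 := eq_of_subset_of_card_le (subset_union_left : x ⊆ x ∪ y) (by omega)
    have e2 := eq_of_subset_of_card_le (subset_union_right : y ⊆ x ∪ y) (by omega)
    exact hxy (e1.trans e2.symm)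
  refine h1.trans ?_
  rw [← card_image_of_injective (x ∪ y) (singleton_injective (α := Fin n))]
  refine card_le_card fun z hz => ?_
  obtain ⟨i, hi, rfl⟩ := mem_image.1 hz
  rw [mem_shadow_iterate_iff_exists_mem_card_add]
  rcases mem_union.1 hi with hi | hi
  · exact ⟨x, hx, by simpa using hi, by rw [hF hx, card_singleton]; omega⟩
  · exact ⟨y, hy, by simpa using hi, by rw [hF hy, card_singleton]; omega⟩

end Cascade

/-! ### From b-colorings to families of bounded cross-diameter -/

section CrossDiameter

/-- Distances to `y` and to its complement add up to `n`, so `T` avoids the `q`-neighborhood of the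
complements of `D`. -/
theorem card_add_le_of_card_symmDiff_le {n p l q f g : ℕ} {T D : Finset (Finset (Fin n))}
    (hTD : ∀ x ∈ T, ∀ y ∈ D, #(x ∆ y) ≤ p) (hpq : p + q + 1 = n) (hl : l < n) (hq : q ≤ l)
    (hD : 2 ^ n + f ≤ #D + ∑ i ∈ range (l + 1), n.choose i) (hf : f ≤ n.choose l)
    (hg : ∀ F : Finset (Finset (Fin n)), (F : Set (Finset (Fin n))).Sized l → f ≤ #F →
      g ≤ #(∂^[q] F)) :
    #T + g ≤ ∑ i ∈ range (l - q + 1), n.choose i := by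
  have h1 := card_compl_iterate_closedNbhd_add_le (A := Dᶜˢ) (l := l) (q := q) (f := f) (g := g)
    (by simpa using hl) hq (by simpa using hD) (by simpa using hf) hg
  rw [Fintype.card_fin] at h1
  refine (Nat.add_le_add_right (card_le_card fun x hx => ?_) g).trans h1
  rw [mem_compl]
  intro hc
  obtain ⟨a, ha, hxa⟩ := exists_card_symmDiff_le_of_mem_iterate_closedNbhd hc
  rw [mem_compls] at ha
  have h2 := hTD x hx _ ha
  have h3 : x ∆ aᶜ = (x ∆ a)ᶜ := by
    ext i
    simp only [mem_symmDiff, mem_compl]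
    tauto
  rw [h3, card_compl, Fintype.card_fin] at h2
  omega

theorem card_symmDiff_le_of_walk {n : ℕ} {x y : Finset (Fin n)} (w : (hypercube n).Walk x y) :
    #(x ∆ y) ≤ w.length := by
  induction w with
  | nil => simp
  | @cons a b c h w ih =>
    have h1 : a ∆ c ⊆ (a ∆ b) ∪ (b ∆ c) := symmDiff_triangle a b c
    have h2 := (card_le_card h1).trans (card_union_le _ _)
    have h3 : #(a ∆ b) = 1 := h
    rw [SimpleGraph.Walk.length_cons]
    omega

theorem card_symmDiff_le_of_power_adj {n p : ℕ} {x y : Finset (Fin n)}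
    (h : ((hypercube n).power p).Adj x y) : #(x ∆ y) ≤ p := by
  have h1 : (hypercube n).edist x y ≠ ⊤ := fun hc => by
    have := h.2
    rw [hc] at this
    exact absurd this (by simp)
  obtain ⟨w, hw⟩ := SimpleGraph.exists_walk_of_edist_ne_top h1
  have h2 := h.2
  rw [← hw] at h2
  exact (card_symmDiff_le_of_walk w).trans (by exact_mod_cast h2)

/-- In a b-coloring, the singleton color classes are adjacent to the dominating vertices. -/
theorem SimpleGraph.BColorable.exists_dominating {V : Type*} [Fintype V] [DecidableEq V]
    {G : SimpleGraph V} {k : ℕ} (h : G.BColorable k) :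
    ∃ T D : Finset V, #D = k ∧ 2 * k ≤ Fintype.card V + #T ∧
      ∀ x ∈ T, ∀ y ∈ D, x = y ∨ G.Adj x y := by
  obtain ⟨C, hC⟩ := h
  choose v hv hdom using hC
  have hinj : Function.Injective v := fun c d hcd => by rw [← hv c, hcd, hv d]
  set S : Finset (Fin k) := {c | #{x | C x = c} = 1} with hS
  have hone : ∀ c ∈ S, ∀ x, C x = c → x = v c := by
    intro c hc x hx
    rw [hS, mem_filter, card_eq_one] at hc
    obtain ⟨-, a, ha⟩ := hc
    have h1 : x ∈ ({a} : Finset V) := ha ▸ by simp [hx]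
    have h2 : v c ∈ ({a} : Finset V) := ha ▸ by simp [hv]
    rw [mem_singleton.1 h1, mem_singleton.1 h2]
  refine ⟨S.image v, univ.image v, ?_, ?_, ?_⟩
  · rw [card_image_of_injective _ hinj, card_univ, Fintype.card_fin]
  · rw [card_image_of_injective _ hinj, ← card_univ (α := V),
      card_eq_sum_card_fiberwise (f := C) (t := univ) (by simp), card_filter, ← sum_add_distrib]
    calc 2 * k = ∑ _c : Fin k, 2 := by simp [mul_comm]
      _ ≤ _ := sum_le_sum fun c _ => by
        have : 0 < #{x | C x = c} := card_pos.2 ⟨v c, by simp [hv]⟩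
        split_ifs with h <;> omega
  · intro x hx y hy
    obtain ⟨c, hc, rfl⟩ := mem_image.1 hx
    obtain ⟨d, -, rfl⟩ := mem_image.1 hy
    by_cases hcd : c = d
    · exact Or.inl (by rw [hcd])
    · obtain ⟨w, hw, hwc⟩ := hdom d c hcd
      rw [hone c hc w hwc] at hw
      exact Or.inr hw.symm

theorem exists_cross_of_bColorable_power {n p k : ℕ}
    (h : ((hypercube n).power p).BColorable k) :
    ∃ T D : Finset (Finset (Fin n)), #D = k ∧ 2 * k ≤ 2 ^ n + #T ∧
      ∀ x ∈ T, ∀ y ∈ D, #(x ∆ y) ≤ p := by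
  obtain ⟨T, D, h1, h2, h3⟩ := h.exists_dominating
  refine ⟨T, D, h1, by simpa using h2, fun x hx y hy => ?_⟩
  rcases h3 x hx y hy with rfl | h4
  · simp
  · exact card_symmDiff_le_of_power_adj h4

end CrossDiameter

/-! ### Binomial inequalities -/

section Binomial

theorem choose_add_mul_choose_le (x k d : ℕ) :
    x.choose (k + 1) + d * x.choose k ≤ (x + d).choose (k + 1) := by
  induction d with
  | zero => simp
  | succ d ih =>
    have h1 : (x + (d + 1)).choose (k + 1) = (x + d).choose k + (x + d).choose (k + 1) :=
      Nat.choose_succ_succ _ _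
    have h2 : x.choose k ≤ (x + d).choose k := Nat.choose_le_choose k (by omega)
    rw [h1, Nat.add_mul]
    omega

theorem sum_range_choose_even_halfway (m : ℕ) :
    ∑ i ∈ range (m + 2), (2 * m + 2).choose i = 2 * 4 ^ m + (2 * m + 1).choose (m + 1) := by
  have h := Nat.sum_range_choose_halfway m
  have h1 : ∀ i, (2 * m + 2).choose (i + 1) =
      (2 * m + 1).choose i + (2 * m + 1).choose (i + 1) := fun i => Nat.choose_succ_succ _ _
  have h2 := sum_range_succ' (fun i => (2 * m + 1).choose i) (m + 1)
  have h3 := sum_range_succ (fun i => (2 * m + 1).choose i) (m + 1)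
  rw [sum_range_succ', sum_congr rfl fun i _ => h1 i, sum_add_distrib]
  simp only [Nat.choose_zero_right] at *
  omega

/-- The last term of the sum and the extra binomial suffice: expand both by Pascal's rule around row
`m + e`. -/
theorem three_mul_choose_le_of_even {m e : ℕ} (he : 1 ≤ e) (hem : e ≤ m) :
    3 * (m + e).choose e ≤
      (∑ i ∈ range (e + 1), (2 * m + 2).choose i) + (2 * m + 1).choose e := by
  obtain ⟨k, rfl⟩ : ∃ k, e = k + 1 := ⟨e - 1, by omega⟩
  obtain ⟨d, rfl⟩ : ∃ d, m = k + 1 + d := ⟨m - (k + 1), by omega⟩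
  have h1 := choose_add_mul_choose_le (k + 1 + d + (k + 1)) k (d + 1)
  have h2 := choose_add_mul_choose_le (k + 1 + d + (k + 1)) k (d + 2)
  rw [show k + 1 + d + (k + 1) + (d + 1) = 2 * (k + 1 + d) + 1 by ring] at h1
  rw [show k + 1 + d + (k + 1) + (d + 2) = 2 * (k + 1 + d) + 2 by ring] at h2
  have h3 := Nat.choose_succ_right_eq (k + 1 + d + (k + 1)) k
  rw [show k + 1 + d + (k + 1) - k = k + d + 2 by omega] at h3
  rw [sum_range_succ]
  generalize (k + 1 + d + (k + 1)).choose (k + 1) = a at *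
  generalize (k + 1 + d + (k + 1)).choose k = c at *
  have h4 : a ≤ (2 * d + 3) * c := by
    refine Nat.le_of_mul_le_mul_right (c := k + 1) ?_ (by omega)
    rw [h3]
    have : k + d + 2 ≤ (2 * d + 3) * (k + 1) := by nlinarith
    nlinarith [Nat.mul_le_mul_left c this]
  generalize (2 * (k + 1 + d) + 2).choose (k + 1) = b at *
  generalize (2 * (k + 1 + d) + 1).choose (k + 1) = b' at *
  have h5 : (d + 1) * c + (d + 2) * c = (2 * d + 3) * c := by ring
  omega

theorem three_mul_choose_le_of_odd {m e : ℕ} (he : 2 ≤ e) (hem : e + 1 ≤ m) :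
    3 * (m + e).choose e ≤ (∑ i ∈ range (e + 1), (2 * m + 1).choose i) + 2 := by
  -- The summand 2 is needed at `e = 2`, `m = 3`, where the left side is 30 and the sum 29.
  rcases he.eq_or_lt with rfl | he
  · have h1 := Nat.choose_succ_right_eq (m + 2) 1
    have h2 := Nat.choose_succ_right_eq (2 * m + 1) 1
    simp only [sum_range_succ, sum_range_zero, Nat.choose_zero_right, Nat.choose_one_right] at *
    rw [show m + 2 - 1 = m + 1 by omega] at h1
    rw [show 2 * m + 1 - 1 = 2 * m by omega] at h2
    norm_num at h1 h2
    nlinarith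
  · obtain ⟨x, rfl⟩ : ∃ x, e = x + 3 := ⟨e - 3, by omega⟩
    obtain ⟨y, rfl⟩ : ∃ y, m = x + 3 + 1 + y := ⟨m - (x + 3 + 1), by omega⟩
    -- The estimate by the last two terms reduces to `1 ≤ xy + x + y`, which fails only here (`e =
    -- 3`, `m = 4`).
    by_cases hxy : x + y = 0
    · obtain rfl : x = 0 := by omega
      obtain rfl : y = 0 := by omega
      decide
    have h1 := choose_add_mul_choose_le (x + 3 + 1 + y + (x + 3)) (x + 2) (y + 2)
    rw [show x + 3 + 1 + y + (x + 3) + (y + 2) = 2 * (x + 3 + 1 + y) + 1 by ring] at h1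
    have h2 : (x + 3 + 1 + y + (x + 3)).choose (x + 2) ≤
        (2 * (x + 3 + 1 + y) + 1).choose (x + 2) := Nat.choose_le_choose _ (by omega)
    have h3 := Nat.choose_succ_right_eq (x + 3 + 1 + y + (x + 3)) (x + 2)
    rw [show x + 3 + 1 + y + (x + 3) - (x + 2) = x + y + 5 by omega] at h3
    rw [sum_range_succ, sum_range_succ]
    change 3 * (x + 3 + 1 + y + (x + 3)).choose (x + 2 + 1) ≤ _ + _ +
      (2 * (x + 3 + 1 + y) + 1).choose (x + 2 + 1) + 2
    generalize (x + 3 + 1 + y + (x + 3)).choose (x + 2 + 1) = a at *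
    generalize (x + 3 + 1 + y + (x + 3)).choose (x + 2) = c at *
    have h4 : 2 * a ≤ (y + 3) * c := by
      refine Nat.le_of_mul_le_mul_right (c := x + 2 + 1) ?_ (by omega)
      rw [mul_assoc, h3]
      have : 2 * (x + y + 5) ≤ (y + 3) * (x + 2 + 1) := by
        nlinarith [Nat.zero_le (x * y), Nat.pos_of_ne_zero hxy]
      nlinarith [Nat.mul_le_mul_left c this]
    have h5 : (y + 2) * c + c = (y + 3) * c := by ring
    omega

end Binomial

/-! ### Bounds on the number of colors -/

section Bounds

/-- A violation of the bound gives `k ≥ N + f` by `hR`, so `ht` applies. The 2 in `hR` reflects that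
below the threshold `k ≤ N + f - 1`. -/
theorem le_add_half_of_cross {N k t f g R : ℕ} (hk : 2 * k ≤ 2 * N + t)
    (ht : N + f ≤ k → t + g ≤ R) (hR : g + 2 * f ≤ R + 2) :
    (k : ℤ) ≤ N + ((R : ℤ) - g) / 2 := by
  by_contra! hc
  have := ht (by omega)
  omega

theorem bColorable_power_le_odd {m e k : ℕ} (he : 1 ≤ e) (hem : e + 1 ≤ m)
    (h : ((hypercube (2 * m + 1)).power (m + e)).BColorable k) :
    (k : ℤ) ≤ (4 ^ m : ℕ) +
      (((∑ i ∈ range (e + 1), (2 * m + 1).choose i : ℕ) : ℤ) - ((m + e).choose e : ℕ)) / 2 := by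
  obtain ⟨T, D, hD, hk, hTD⟩ := exists_cross_of_bColorable_power h
  have hpow : 2 ^ (2 * m + 1) = 2 * 4 ^ m := by rw [pow_succ, pow_mul]; norm_num [mul_comm]
  rw [hpow] at hk
  have hsum := Nat.sum_range_choose_halfway m
  have hidx : m - (m - e) = e := by omega
  -- For `e = 1` the choice `f = m + 1` is too large for `hR`; two sets of size `m` already have the
  -- shadow `g = m + 1`.
  rcases he.eq_or_lt with rfl | he
  · refine le_add_half_of_cross (f := 2) hk (fun hf => ?_) ?_
    · have := card_add_le_of_card_symmDiff_le (l := m) (q := m - 1) (f := 2) (g := m + 1) hTD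
        (by omega) (by omega) (by omega) (by omega) ?_ ?_
      · rw [hidx] at this
        rwa [Nat.choose_one_right]
      · have := Nat.choose_le_choose m (show m + 1 ≤ 2 * m + 1 by omega)
        rw [Nat.choose_succ_self_right] at this
        omega
      · intro F hF hFf
        obtain ⟨l, rfl⟩ : ∃ l, m = l + 1 := ⟨m - 1, by omega⟩
        exact add_two_le_card_iterate_shadow hF hFf
    · simp only [sum_range_succ, sum_range_zero, Nat.choose_zero_right, Nat.choose_one_right]
      omega
  · refine le_add_half_of_cross (f := (m + e).choose e) hk (fun hf => ?_) ?_
    · have hsymm : (m + e).choose m = (m + e).choose e := Nat.choose_symm_add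
      have := card_add_le_of_card_symmDiff_le (l := m) (q := m - e) (f := (m + e).choose e)
        (g := (m + e).choose e) hTD (by omega) (by omega) (by omega) (by omega) ?_ ?_
      · rwa [hidx] at this
      · rw [← hsymm]
        exact Nat.choose_le_choose m (by omega)
      · intro F hF hFf
        rw [← hsymm] at hFf
        have := kruskal_katona_lovasz_form (i := m - e) (k := m + e) (by omega) (by omega)
          (by omega) hF hFf
        rwa [hidx] at this
    · have := three_mul_choose_le_of_odd he hem
      omega

theorem bColorable_power_le_even {m e k : ℕ} (he : 1 ≤ e) (hem : e + 1 ≤ m)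
    (h : ((hypercube (2 * m + 2)).power (m + 1 + e)).BColorable k) :
    (k : ℤ) ≤ (2 * 4 ^ m : ℕ) +
      ((((∑ i ∈ range (e + 1), (2 * m + 2).choose i) + (2 * m + 1).choose e : ℕ) : ℤ) -
        ((m + e).choose e : ℕ)) / 2 := by
  obtain ⟨T, D, hD, hk, hTD⟩ := exists_cross_of_bColorable_power h
  have hpow : 2 ^ (2 * m + 2) = 2 * (2 * 4 ^ m) := by rw [pow_add, pow_mul]; norm_num; ring
  rw [hpow] at hk
  have hsum := sum_range_choose_even_halfway m
  have hsymm : (m + e).choose m = (m + e).choose e := Nat.choose_symm_add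
  refine le_add_half_of_cross (f := (m + e).choose e) hk (fun hf => ?_) ?_
  -- Half the cube is the layers above the middle one plus half of the middle layer, `(2 * m +
  -- 1).choose (m + 1)` sets. With the surplus this is a two-term cascade, whose first shadow term
  -- leaves `(2 * m + 1).choose e` of layer `e + 1`.
  · have := card_add_le_of_card_symmDiff_le (l := m + 1) (q := m - e)
      (f := (2 * m + 1).choose (m + 1) + (m + e).choose m)
      (g := (2 * m + 1).choose (e + 1) + (m + e).choose e) hTD
      (by omega) (by omega) (by omega) (by rw [hsum]; omega) ?_ ?_
    · rw [show m + 1 - (m - e) = e + 1 by omega, sum_range_succ,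
        Nat.choose_succ_succ' (2 * m + 1) e] at this
      omega
    · rw [Nat.choose_succ_succ (2 * m + 1) m, add_comm]
      exact Nat.add_le_add_right (Nat.choose_le_choose m (by omega)) _
    · intro F hF hFf
      have := two_term_le_card_iterate_shadow (q := m - e) rfl (by omega) (by omega) (by omega)
        (by omega) hF hFf
      rwa [show m - (m - e) = e by omega] at this
  · have := three_mul_choose_le_of_even he (by omega : e ≤ m)
    omega

end Bounds

theorem theorem4p7 :
    (∀ n p : ℕ, Odd n → 5 ≤ n → (n + 1) / 2 ≤ p → p ≤ n - 2 →
      ∀ r s : ℕ,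
        r = ∑ i ∈ Finset.range (p - (n - 1) / 2 + 1), n.choose i →
        s = p.choose (p - (n - 1) / 2) →
        (((hypercube n).power p).bChromaticNumber : ℤ) ≤ 2 ^ (n - 1) + ((r : ℤ) - (s : ℤ)) / 2) ∧
    (∀ n p : ℕ, Even n → 6 ≤ n → n / 2 + 1 ≤ p → p ≤ n - 2 →
      ∀ r' s' : ℕ,
        r' = (∑ i ∈ Finset.range (p - n / 2 + 1), n.choose i) + (n - 1).choose (p - n / 2) →
        s' = (p - 1).choose (p - n / 2) →
        (((hypercube n).power p).bChromaticNumber : ℤ) ≤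
          2 ^ (n - 1) + ((r' : ℤ) - (s' : ℤ)) / 2) := by
  constructor
  · rintro n p ⟨m, rfl⟩ hn hp hp' r s rfl rfl
    obtain ⟨e, rfl⟩ : ∃ e, p = m + e := ⟨p - m, by omega⟩
    have h := bColorable_power_le_odd (m := m) (e := e) (by omega) (by omega)
      (SimpleGraph.isGreatest_bChromaticNumber _).1
    rw [show m + e - (2 * m + 1 - 1) / 2 = e by omega]
    refine h.trans (le_of_eq ?_)
    rw [Nat.add_sub_cancel, pow_mul]
    push_cast
    norm_num
  · rintro n p ⟨M, rfl⟩ hn hp hp' r s rfl rfl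
    obtain ⟨m, rfl⟩ : ∃ m, M = m + 1 := ⟨M - 1, by omega⟩
    obtain ⟨e, rfl⟩ : ∃ e, p = m + 1 + e := ⟨p - (m + 1), by omega⟩
    rw [show m + 1 + (m + 1) = 2 * m + 2 by ring] at *
    have h := bColorable_power_le_even (m := m) (e := e) (by omega) (by omega)
      (SimpleGraph.isGreatest_bChromaticNumber _).1
    rw [show m + 1 + e - (2 * m + 2) / 2 = e by omega, show m + 1 + e - 1 = m + e by omega,
      show 2 * m + 2 - 1 = 2 * m + 1 by omega]
    refine h.trans (le_of_eq ?_)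
    rw [pow_succ, pow_mul]
    push_cast
    norm_num [mul_comm]
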